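/- Let $\mathcal H$ be a separable complex Hilbert space and let $S:D_S\to\mathcal H$ be a closed, densely defined linear operator in $\mathcal H$ such that $0$ belongs to the limit spectrum of the adjoint $S^*$, that is, there is an orthonormal sequence $(e_n)_{n\ge 1}$ in $D_{S^*}$ with $\|S^*e_n\|\to 0$. For a locally compact space $X$ and a Banach space $B$, let $C(X,B)$ denote the space of continuous functions $X\to B$ that vanish at infinity, and let $L_2=L_2(\mathbb R)$ be the space of complex square-integrable functions for Lebesgue measure. Then there are an orthonormal basis $(f_n)_{n\ge1}$ of $\mathcal H$, an orthonormal basis $(u_n)_{n\ge1}$ of $L_2$ whose members are arbitrarily smooth (each $u_n$ has a representative that has derivatives of all orders and that is in $C(\mathbb R,\mathbb C)$ together with all its derivatives), and a unitary operator $U_\infty:\mathcal H\to L_2$ with $U_\infty f_n=u_n$ for all $n$, such that $T=U_\infty SU_\infty^{-1}$, with domain $D_T=U_\infty D_S$, is a Carleman integral operator having an $SK^\infty$-kernel. Explicitly, there is a function $K:\mathbb R^2\to\mathbb C$ such that: 1. $K$ is measurable, $K(s,\cdot)\in L_2$ for almost every $s\in\mathbb R$, and for every $f\in D_T$ $$(Tf)(s)=\int_{\mathbb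 R}K(s,t)f(t)\,dt\quad\text{for almost every } s\in\mathbb R;$$ 2. $K$ has partial derivatives of all orders on $\mathbb R^2$, and $K$ and all its partial derivatives are in $C(\mathbb R^2,\mathbb C)$; 3. $K(s,\cdot)\in L_2$ for every $s\in\mathbb R$, and the Carleman function $k:\mathbb R\to L_2$, $k(s)=\overline{K(s,\cdot)}$, has strong derivatives of all orders, and $k$ and all these derivatives are in $C(\mathbb R,L_2)$. -/

import Mathlib

open MeasureTheory Filter Topology
open scoped ComplexConjugate

noncomputable section

/-- The Hilbert space `L₂ = L₂(ℝ)` of classes of square-integrable complex functions on the line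
with Lebesgue measure. -/
abbrev L2R : Type := Lp ℂ 2 (volume : Measure ℝ)

section Operators

variable {H G : Type*} [NormedAddCommGroup H] [InnerProductSpace ℂ H]
  [NormedAddCommGroup G] [InnerProductSpace ℂ G]

/-- The limit spectrum of an operator `S`: the numbers `z` such that `‖(S - z) eₙ‖ → 0` for some
orthonormal sequence `(eₙ)` in the domain of `S`. -/
def limitSpectrum (S : H →ₗ.[ℂ] H) : Set ℂ :=
  {z | ∃ e : ℕ → S.domain, Orthonormal ℂ (fun n => (e n : H)) ∧
    Tendsto (fun n => ‖S (e n) - z • (e n : H)‖) atTop (𝓝 0)}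

/-- The closed, densely defined operators `S` such that `z` lies in the limit spectrum of the
adjoint `S*`. -/
def closedOpsWithAdjointLimitPoint (H : Type*) [NormedAddCommGroup H] [InnerProductSpace ℂ H]
    [CompleteSpace H] (z : ℂ) : Set (H →ₗ.[ℂ] H) :=
  {S | Dense (S.domain : Set H) ∧ S.IsClosed ∧ z ∈ limitSpectrum S.adjoint}

/-- The operator `U S U⁻¹`, with domain `U D_S = {g | U⁻¹ g ∈ D_S}`. -/
def unitaryConj (U : H ≃ₗᵢ[ℂ] G) (S : H →ₗ.[ℂ] H) : G →ₗ.[ℂ] G where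
  domain := S.domain.comap (U.symm.toLinearEquiv : G →ₗ[ℂ] H)
  toFun :=
    { toFun := fun g => U (S ⟨U.symm (g : G), g.2⟩)
      map_add' := fun x y => by
        rw [← map_add, ← S.map_add]
        congr 2
        exact Subtype.ext (map_add U.symm (x : G) (y : G))
      map_smul' := fun c x => by
        rw [RingHom.id_apply, ← map_smul, ← S.map_smul]
        congr 2
        exact Subtype.ext (map_smul U.symm c (x : G)) }

end Operators

/-! Integral operators and Carleman kernels -/

/-- `T` is an integral operator in `L₂` with kernel `K`: the domain of `T` is dense, `K` is
(Lebesgue) measurable on the plane, and, for every `f` in the domain of `T`,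
`(T f)(s) = ∫ K(s,t) f(t) dt` for almost every `s`, the integral existing in the sense of
Lebesgue. -/
structure IsIntegralOperator (T : L2R →ₗ.[ℂ] L2R) (K : ℝ → ℝ → ℂ) : Prop where
  dense_domain : Dense (T.domain : Set L2R)
  measurable_kernel :
    AEStronglyMeasurable (fun p : ℝ × ℝ => K p.1 p.2) (volume : Measure (ℝ × ℝ))
  apply_eq : ∀ f : T.domain, ∀ᵐ s : ℝ,
    Integrable (fun t : ℝ => K s t * (f : L2R) t) ∧ (T f) s = ∫ t : ℝ, K s t * (f : L2R) t

/-- A kernel is Carleman if `K(s,·)` is in `L₂` for almost every `s`. -/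
def IsCarlemanKernel (K : ℝ → ℝ → ℂ) : Prop :=
  ∀ᵐ s : ℝ, MemLp (K s) 2 (volume : Measure ℝ)

/-- `T` is a Carleman integral operator with kernel `K`. -/
def IsCarlemanOperator (T : L2R →ₗ.[ℂ] L2R) (K : ℝ → ℝ → ℂ) : Prop :=
  IsIntegralOperator T K ∧ IsCarlemanKernel K

/-- `k` is the Carleman function `s ↦ conj K(s,·)` of `K`, defined for every real `s`; the
existence of such a `k` says that `K(s,·)` is in `L₂` for every `s`. -/
def IsCarlemanFunction (K : ℝ → ℝ → ℂ) (k : ℝ → L2R) : Prop :=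
  ∀ s : ℝ, (k s : ℝ → ℂ) =ᵐ[volume] fun t => conj (K s t)

/-! Smoothness with decay at infinity -/

/-- Continuous functions that vanish at infinity, the elements of `C(X,B)`. -/
def IsC0 {X B : Type*} [TopologicalSpace X] [TopologicalSpace B] [Zero B] (f : X → B) : Prop :=
  Continuous f ∧ Tendsto f (cocompact X) (𝓝 0)

/-- A function of one real variable with values in a normed space has (strong) derivatives up to
order `m`, and it and these derivatives are in `C(ℝ,B)`. -/
def HasC0Derivs {B : Type*} [NormedAddCommGroup B] [NormedSpace ℝ B] (m : ℕ) (f : ℝ → B) : Prop :=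
  ContDiff ℝ m f ∧ ∀ i ≤ m, IsC0 (iteratedDeriv i f)

/-- `K` has all partial derivatives, mixed ones in any order included, up to total order `m`, and
it and all these derivatives are in `C(ℝ²,ℂ)`. In the recursion `K₁ = ∂K/∂s` and `K₂ = ∂K/∂t`. -/
def HasC0Partials : ℕ → (ℝ → ℝ → ℂ) → Prop
  | 0, K => IsC0 (fun p : ℝ × ℝ => K p.1 p.2)
  | m + 1, K => IsC0 (fun p : ℝ × ℝ => K p.1 p.2) ∧
      ∃ K₁ K₂ : ℝ → ℝ → ℂ,
        (∀ s t, HasDerivAt (fun x => K x t) (K₁ s t) s) ∧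
        (∀ s t, HasDerivAt (fun y => K s y) (K₂ s t) t) ∧
        HasC0Partials m K₁ ∧ HasC0Partials m K₂

/-- `SK^m`-kernels: (i) the kernel and its partial derivatives up to order `m` are in `C(ℝ²,ℂ)`;
(ii) its Carleman function and the strong derivatives of it up to order `m` are in `C(ℝ,L₂)`. -/
def IsSKKernel (m : ℕ) (K : ℝ → ℝ → ℂ) : Prop :=
  HasC0Partials m K ∧ ∃ k : ℝ → L2R, IsCarlemanFunction K k ∧ HasC0Derivs m k

/-- `SK^∞`-kernels. -/
def IsSKInftyKernel (K : ℝ → ℝ → ℂ) : Prop :=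
  ∀ m : ℕ, IsSKKernel m K

/-- A class in `L₂` is arbitrarily smooth if it contains a function all of whose derivatives exist
and are, like the function itself, in `C(ℝ,ℂ)`. -/
def IsArbitrarilySmooth (v : L2R) : Prop :=
  ∃ φ : ℝ → ℂ, (v : ℝ → ℂ) =ᵐ[volume] φ ∧ ∀ m : ℕ, HasC0Derivs m φ

end

/-! Series of Schwartz functions -/

/-! Let `f n` be a basis of H inside the domain of S*, let `u n` be a basis of L₂ made of Schwartz
functions, and let U send `f n` to `u n`. Since ⟪f n, S x⟫ = ⟪S* f n, x⟫, expanding Tg in the basis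
`u n` gives (Tg)(s) = ⟪k(s), g⟫ with k(s) = ∑ conj(u n (s)) U S* f n. Expanding U S* f n in turn
gives the kernel K(s,t) = ∑ ⟪S* f n, f m⟫ u n (s) conj(u m (t)). Both series may be differentiated
termwise to every order, with limits vanishing at infinity, once ‖S* f n‖ and ⟪S* f n, f m⟫ remain
summable after multiplication by the sup norms of any fixed derivatives of the basis functions.

The two bases are chosen together so that this holds (`exists_orthonormal_pair`). Completeness
forces some vectors on each side, over which there is no control, but never on both sides at once.
When `u n` is forced, `f n` is taken near a late term of the sequence on which S* tends to zero;
that sequence is also weakly null, which makes ⟪S* f m, f n⟫ small for earlier m. When `f n` is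
forced, `u n` is taken near a wide dilate, a unit vector with uniformly small derivatives
(`exists_schwartz_spreading`). Closedness of S makes the domain of S* dense
(`LinearPMap.dense_adjoint_domain`), so that a basis can be found inside it. -/

theorem SchwartzMap.iteratedDeriv_eq_derivCLM_iterate (φ : SchwartzMap ℝ ℂ) (i : ℕ) :
    iteratedDeriv i φ = ⇑((SchwartzMap.derivCLM ℂ ℂ)^[i] φ) := by
  induction i generalizing φ with
  | zero => simp
  | succ i ih =>
    rw [iteratedDeriv_succ', Function.iterate_succ_apply, ← ih]
    rfl

theorem SchwartzMap.hasC0Derivs (φ : SchwartzMap ℝ ℂ) (m : ℕ) : HasC0Derivs m φ := by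
  refine ⟨φ.smooth m, fun i _ => ?_⟩
  rw [SchwartzMap.iteratedDeriv_eq_derivCLM_iterate]
  exact ⟨SchwartzMap.continuous _, SchwartzMap.tendsto_cocompact _⟩

theorem SchwartzMap.seminorm_derivCLM_le (φ : SchwartzMap ℝ ℂ) (i : ℕ) :
    SchwartzMap.seminorm ℂ 0 i (SchwartzMap.derivCLM ℂ ℂ φ) ≤ SchwartzMap.seminorm ℂ 0 (i + 1) φ := by
  refine SchwartzMap.seminorm_le_bound' ℂ 0 i _ (apply_nonneg _ _) fun x => ?_
  have h := φ.le_seminorm' ℂ 0 (i + 1) x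
  rw [iteratedDeriv_succ'] at h
  exact h

theorem SchwartzMap.hasDerivAt_derivCLM (φ : SchwartzMap ℝ ℂ) (x : ℝ) :
    HasDerivAt φ (SchwartzMap.derivCLM ℂ ℂ φ x) x :=
  φ.differentiableAt.hasDerivAt

theorem isC0_tsum {ι X B : Type*} [TopologicalSpace X] [NormedAddCommGroup B] [CompleteSpace B]
    {g : ι → X → B} {b : ι → ℝ} (hb : Summable b) (hg : ∀ i, IsC0 (g i))
    (hgb : ∀ i x, ‖g i x‖ ≤ b i) : IsC0 (fun x => ∑' i, g i x) := by
  refine ⟨continuous_tsum (fun i => (hg i).1) hb hgb, ?_⟩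
  have h := tendsto_tsum_of_dominated_convergence (𝓕 := cocompact X) (f := fun x i => g i x)
    (g := fun _ => (0 : B)) hb (fun i => (hg i).2) (Eventually.of_forall fun x i => hgb i x)
  simpa using h

/-- When a point leaves every compact set of the product, at least one coordinate leaves every
compact set; that factor tends to zero while the other stays bounded. -/
theorem isC0_mul_prod {X Y : Type*} [TopologicalSpace X] [TopologicalSpace Y] {a : X → ℂ} {b : Y → ℂ}
    {A B : ℝ} (ha : IsC0 a) (hb : IsC0 b) (hA : ∀ x, ‖a x‖ ≤ A) (hB : ∀ y, ‖b y‖ ≤ B) :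
    IsC0 (fun p : X × Y => a p.1 * b p.2) := by
  refine ⟨(ha.1.comp continuous_fst).mul (hb.1.comp continuous_snd), ?_⟩
  rw [← Filter.coprod_cocompact, Filter.coprod, tendsto_sup]
  constructor
  · exact (ha.2.comp tendsto_comap).zero_mul_isBoundedUnder_le
      (isBoundedUnder_of ⟨B, fun p => hB p.2⟩)
  · exact isBoundedUnder_le_mul_tendsto_zero (isBoundedUnder_of ⟨A, fun p : X × Y => hA p.1⟩)
      (hb.2.comp tendsto_comap)

theorem SchwartzMap.isC0_conj (φ : SchwartzMap ℝ ℂ) : IsC0 (fun x => conj (φ x)) :=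
  ⟨Complex.continuous_conj.comp φ.continuous, by
    have h := (Complex.continuous_conj.tendsto 0).comp φ.tendsto_cocompact
    rwa [map_zero] at h⟩

theorem SchwartzMap.norm_mul_conj_le (φ ψ : SchwartzMap ℝ ℂ) (s t : ℝ) :
    ‖φ s * conj (ψ t)‖ ≤ SchwartzMap.seminorm ℂ 0 0 φ * SchwartzMap.seminorm ℂ 0 0 ψ := by
  rw [norm_mul, RCLike.norm_conj]
  exact mul_le_mul (φ.norm_le_seminorm ℂ s) (ψ.norm_le_seminorm ℂ t) (norm_nonneg _)
    (apply_nonneg _ _)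

/-- Differentiating in s or t replaces every φ or every ψ by its derivative, which only shifts i or
j in the hypothesis. Summability for all i and j is therefore preserved, and induction on the order
applies. -/
theorem hasC0Partials_tsum {ι : Type*} (m : ℕ) (c : ι → ℂ) (φ ψ : ι → SchwartzMap ℝ ℂ)
    (h : ∀ i j, Summable fun p => ‖c p‖ *
      (SchwartzMap.seminorm ℂ 0 i (φ p) * SchwartzMap.seminorm ℂ 0 j (ψ p))) :
    HasC0Partials m (fun s t => ∑' p, c p * (φ p s * conj (ψ p t))) := by
  have bound : ∀ (φ ψ : ι → SchwartzMap ℝ ℂ) p s t, ‖c p * (φ p s * conj (ψ p t))‖ ≤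
      ‖c p‖ * (SchwartzMap.seminorm ℂ 0 0 (φ p) * SchwartzMap.seminorm ℂ 0 0 (ψ p)) := by
    intro φ ψ p s t
    rw [norm_mul]
    exact mul_le_mul_of_nonneg_left (SchwartzMap.norm_mul_conj_le _ _ _ _) (norm_nonneg _)
  have base : ∀ (φ ψ : ι → SchwartzMap ℝ ℂ), (Summable fun p => ‖c p‖ *
      (SchwartzMap.seminorm ℂ 0 0 (φ p) * SchwartzMap.seminorm ℂ 0 0 (ψ p))) →
      IsC0 (fun x : ℝ × ℝ => ∑' p, c p * (φ p x.1 * conj (ψ p x.2))) := by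
    intro φ ψ h
    refine isC0_tsum h (fun p => ?_) fun p x => bound φ ψ p x.1 x.2
    have h2 := isC0_mul_prod (a := φ p) (b := fun t => conj (ψ p t))
      ⟨(φ p).continuous, (φ p).tendsto_cocompact⟩ (ψ p).isC0_conj
      ((φ p).norm_le_seminorm ℂ) (fun t => by
        rw [RCLike.norm_conj]; exact (ψ p).norm_le_seminorm ℂ t)
    exact ⟨h2.1.const_mul _, by simpa using h2.2.const_mul (c p)⟩
  induction m generalizing φ ψ with
  | zero => exact base φ ψ (h 0 0)
  | succ m ih =>
    have h1 : ∀ i j, Summable fun p => ‖c p‖ *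
        (SchwartzMap.seminorm ℂ 0 i (SchwartzMap.derivCLM ℂ ℂ (φ p)) *
          SchwartzMap.seminorm ℂ 0 j (ψ p)) := fun i j =>
      (h (i + 1) j).of_nonneg_of_le (fun p => by positivity) fun p => by
        gcongr; exact SchwartzMap.seminorm_derivCLM_le _ _
    have h2 : ∀ i j, Summable fun p => ‖c p‖ *
        (SchwartzMap.seminorm ℂ 0 i (φ p) *
          SchwartzMap.seminorm ℂ 0 j (SchwartzMap.derivCLM ℂ ℂ (ψ p))) := fun i j =>
      (h i (j + 1)).of_nonneg_of_le (fun p => by positivity) fun p => by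
        gcongr; exact SchwartzMap.seminorm_derivCLM_le _ _
    refine ⟨base φ ψ (h 0 0), _, _, fun s t => ?_, fun s t => ?_,
      ih (fun p => SchwartzMap.derivCLM ℂ ℂ (φ p)) ψ h1,
      ih φ (fun p => SchwartzMap.derivCLM ℂ ℂ (ψ p)) h2⟩
    · exact hasDerivAt_tsum (𝕜 := ℝ) (h1 0 0)
        (fun p y => (((φ p).hasDerivAt_derivCLM y).mul_const _).const_mul (c p))
        (fun p y => bound (fun p => SchwartzMap.derivCLM ℂ ℂ (φ p)) ψ p y t)
        (Summable.of_norm_bounded (h 0 0) fun p => bound φ ψ p s t) s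
    · exact hasDerivAt_tsum (𝕜 := ℝ) (h2 0 0)
        (fun p y => ((((ψ p).hasDerivAt_derivCLM y).star).const_mul _).const_mul (c p))
        (fun p y => bound φ (fun p => SchwartzMap.derivCLM ℂ ℂ (ψ p)) p s y)
        (Summable.of_norm_bounded (h 0 0) fun p => bound φ ψ p s t) t

theorem norm_conj_smul_le {B : Type*} [NormedAddCommGroup B] [NormedSpace ℂ B]
    (φ : SchwartzMap ℝ ℂ) (y : B) (s : ℝ) :
    ‖conj (φ s) • y‖ ≤ SchwartzMap.seminorm ℂ 0 0 φ * ‖y‖ := by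
  rw [norm_smul, RCLike.norm_conj]
  exact mul_le_mul_of_nonneg_right (φ.norm_le_seminorm ℂ s) (norm_nonneg _)

theorem hasC0Derivs_tsum {ι B : Type*} [NormedAddCommGroup B] [NormedSpace ℂ B] [CompleteSpace B]
    (m : ℕ) (φ : ι → SchwartzMap ℝ ℂ) (y : ι → B)
    (h : ∀ i, Summable fun p => SchwartzMap.seminorm ℂ 0 i (φ p) * ‖y p‖) :
    HasC0Derivs m (fun s => ∑' p, conj (φ p s) • y p) := by
  have base : ∀ φ : ι → SchwartzMap ℝ ℂ,
      (Summable fun p => SchwartzMap.seminorm ℂ 0 0 (φ p) * ‖y p‖) →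
      IsC0 (fun s => ∑' p, conj (φ p s) • y p) := fun φ h => by
    refine isC0_tsum h (fun p => ?_) fun p s => norm_conj_smul_le _ _ _
    exact ⟨(φ p).isC0_conj.1.smul continuous_const, by
      simpa using (φ p).isC0_conj.2.smul_const (y p)⟩
  induction m generalizing φ with
  | zero =>
    refine ⟨contDiff_zero.2 (base φ (h 0)).1, fun i hi => ?_⟩
    obtain rfl : i = 0 := by omega
    simpa using base φ (h 0)
  | succ m ih =>
    have h1 : ∀ i, Summable fun p =>
        SchwartzMap.seminorm ℂ 0 i (SchwartzMap.derivCLM ℂ ℂ (φ p)) * ‖y p‖ := fun i =>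
      (h (i + 1)).of_nonneg_of_le (fun p => by positivity) fun p => by
        gcongr; exact SchwartzMap.seminorm_derivCLM_le _ _
    have hd : ∀ s, HasDerivAt (fun s => ∑' p, conj (φ p s) • y p)
        (∑' p, conj (SchwartzMap.derivCLM ℂ ℂ (φ p) s) • y p) s := fun s =>
      hasDerivAt_tsum (𝕜 := ℝ) (h1 0)
        (fun p x => (((φ p).hasDerivAt_derivCLM x).star).smul_const (y p))
        (fun p x => norm_conj_smul_le _ _ _)
        (Summable.of_norm_bounded (h 0) fun p => norm_conj_smul_le _ _ s) s
    have hd' : deriv (fun s => ∑' p, conj (φ p s) • y p) =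
        fun s => ∑' p, conj (SchwartzMap.derivCLM ℂ ℂ (φ p) s) • y p := funext fun s => (hd s).deriv
    obtain ⟨hc, hi⟩ := ih _ h1
    refine ⟨?_, fun i him => ?_⟩
    · push_cast
      rw [contDiff_succ_iff_deriv]
      refine ⟨fun s => (hd s).differentiableAt, by simp, ?_⟩
      rw [hd']; exact hc
    · cases i with
      | zero => simpa using base φ (h 0)
      | succ i =>
        rw [iteratedDeriv_succ', hd']
        exact hi i (by omega)

/-! ### Almost everywhere identification of limits in L² -/

/-- An `L²` limit that is also an almost everywhere limit is the same function. -/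
theorem Lp_ae_eq_of_tendsto {g : ℕ → L2R} {g₀ : L2R} {G : ℝ → ℂ}
    (h : Tendsto g atTop (𝓝 g₀)) (h' : ∀ᵐ t : ℝ, Tendsto (fun n => g n t) atTop (𝓝 (G t))) :
    (g₀ : ℝ → ℂ) =ᵐ[volume] G := by
  obtain ⟨ns, hns, hlim⟩ := (tendstoInMeasure_of_tendsto_Lp h).exists_seq_tendsto_ae
  filter_upwards [hlim, h'] with t h1 h2
  exact tendsto_nhds_unique h1 (h2.comp hns.tendsto_atTop)

theorem Lp_coeFn_sum {ι : Type*} (s : Finset ι) (g : ι → L2R) :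
    (∑ i ∈ s, g i : L2R) =ᵐ[volume] fun t => ∑ i ∈ s, g i t := by
  classical
  induction s using Finset.induction_on with
  | empty =>
    simp only [Finset.sum_empty]
    exact Lp.coeFn_zero ℂ 2 (volume : Measure ℝ)
  | insert a s ha ih =>
    rw [Finset.sum_insert ha]
    filter_upwards [Lp.coeFn_add (g a) (∑ i ∈ s, g i), ih] with t h1 h2
    rw [h1, Pi.add_apply, h2, Finset.sum_insert ha]

/-! Orthonormal sequences built by recursion -/

theorem exists_seq_eq_of_prev {α : Type*} (F : ∀ n : ℕ, (Fin n → α) → α) :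
    ∃ g : ℕ → α, ∀ n, g n = F n (fun i => g i) :=
  ⟨fun n => Nat.strongRec (fun n ih => F n fun i => ih i i.2) n, fun n => by
    beta_reduce
    rw [Nat.strongRec_eq]⟩

theorem orthonormal_fin_succ {E : Type*} [NormedAddCommGroup E] [InnerProductSpace ℂ E]
    {x : ℕ → E} {n : ℕ} (h : Orthonormal ℂ (fun i : Fin n => x i)) (h1 : ‖x n‖ = 1)
    (h0 : ∀ i : Fin n, inner ℂ (x i) (x n) = 0) :
    Orthonormal ℂ (fun i : Fin (n + 1) => x i) := by
  refine ⟨fun i => ?_, fun i j hij => ?_⟩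
  · induction i using Fin.lastCases with
    | last => simpa using h1
    | cast i => exact h.1 i
  · induction i using Fin.lastCases with
    | last =>
      induction j using Fin.lastCases with
      | last => exact absurd rfl hij
      | cast j => exact inner_eq_zero_symm.1 (h0 j)
    | cast i =>
      induction j using Fin.lastCases with
      | last => exact h0 i
      | cast j => exact h.2 fun e => hij (congrArg _ e)

theorem orthonormal_of_fin {E : Type*} [NormedAddCommGroup E] [InnerProductSpace ℂ E]
    {x : ℕ → E} (h : ∀ n, Orthonormal ℂ (fun i : Fin n => x i)) : Orthonormal ℂ x := by
  refine ⟨fun i => (h (i + 1)).1 (Fin.last i), fun i j hij => ?_⟩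
  exact (h (i + j + 1)).2 (i := ⟨i, by omega⟩) (j := ⟨j, by omega⟩) fun e => hij (Fin.mk.inj e)

section Abstract

variable {V E : Type*} [AddCommGroup V] [Module ℂ V] [NormedAddCommGroup E]
  [InnerProductSpace ℂ E]

/-- The vector `v` minus its projection onto the span of an orthonormal family. -/
noncomputable def orthResidual (ι : V →ₗ[ℂ] E) {n : ℕ} (w : Fin n → V) (v : V) : V :=
  v - ∑ i, inner ℂ (ι (w i)) (ι v) • w i

theorem inner_orthResidual (ι : V →ₗ[ℂ] E) {n : ℕ} {w : Fin n → V}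
    (hw : Orthonormal ℂ (fun i => ι (w i))) (v : V) (i : Fin n) :
    inner ℂ (ι (w i)) (ι (orthResidual ι w v)) = 0 := by
  simp only [orthResidual, map_sub, map_sum, map_smul, inner_sub_right]
  rw [hw.inner_right_fintype]
  simp

theorem norm_normalize {ι : V →ₗ[ℂ] E} {v : V} (hv : ι v ≠ 0) :
    ‖ι (((‖ι v‖⁻¹ : ℝ) : ℂ) • v)‖ = 1 := by
  rw [map_smul, norm_smul, Complex.norm_real, norm_inv, norm_norm,
    inv_mul_cancel₀ (norm_ne_zero_iff.2 hv)]

/-- A weakly null sequence of unit vectors on which a seminorm tends to zero gives unit vectors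
orthogonal to finitely many given ones with small seminorm. -/
theorem exists_small_orthogonal (ι : V →ₗ[ℂ] E) {e : ℕ → V} (he : ∀ k, ‖ι (e k)‖ = 1)
    (hweak : ∀ w, Tendsto (fun k => inner ℂ (ι w) (ι (e k))) atTop (𝓝 0))
    {p : Seminorm ℂ V} (hp : Tendsto (fun k => p (e k)) atTop (𝓝 0))
    {n : ℕ} {w : Fin n → V} (hw : Orthonormal ℂ (fun i => ι (w i))) {ε : ℝ} (hε : 0 < ε) :
    ∃ v, ‖ι v‖ = 1 ∧ (∀ i, inner ℂ (ι (w i)) (ι v) = 0) ∧ p v ≤ ε := by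
  -- One null quantity bounds both the norm lost by projecting and the seminorm of the residual.
  -- Below 1/2 it leaves a residual of norm at least 1/2, so normalising at most doubles the
  -- seminorm; hence the threshold ε / 2.
  have hnull : Tendsto (fun k => p (e k) +
      ∑ i, ‖inner ℂ (ι (w i)) (ι (e k))‖ * (‖ι (w i)‖ + p (w i))) atTop (𝓝 0) := by
    have h := hp.add (tendsto_finsetSum Finset.univ fun (i : Fin n) _ =>
      (hweak (w i)).norm.mul_const (‖ι (w i)‖ + p (w i)))
    simpa using h
  obtain ⟨k, hk⟩ := (hnull.eventually_lt_const (u := min (1 / 2) (ε / 2))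
    (lt_min (by norm_num) (by positivity))).exists
  set t := p (e k) + ∑ i, ‖inner ℂ (ι (w i)) (ι (e k))‖ * (‖ι (w i)‖ + p (w i)) with ht
  have h1 : 1 - t ≤ ‖ι (orthResidual ι w (e k))‖ := by
    have a := norm_sub_norm_le (ι (e k)) (∑ i, inner ℂ (ι (w i)) (ι (e k)) • ι (w i))
    have b : ‖∑ i, inner ℂ (ι (w i)) (ι (e k)) • ι (w i)‖ ≤ t := by
      refine (norm_sum_le _ _).trans ((Finset.sum_le_sum fun i _ => ?_).trans
        (le_add_of_nonneg_left (apply_nonneg p _)))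
      rw [norm_smul]
      gcongr
      exact le_add_of_nonneg_right (apply_nonneg p _)
    rw [he] at a
    simp only [orthResidual, map_sub, map_sum, map_smul]
    linarith
  have h2 : p (orthResidual ι w (e k)) ≤ t := by
    refine (map_sub_le_add p _ _).trans ?_
    rw [ht]
    gcongr
    refine (Finset.le_sum_of_subadditive p (map_zero p).le (map_add_le_add p) _ _).trans
      (Finset.sum_le_sum fun i _ => ?_)
    rw [map_smul_eq_mul]
    gcongr
    exact le_add_of_nonneg_left (norm_nonneg _)
  have hk1 := hk.trans_le (min_le_left _ _)
  have hk2 := hk.trans_le (min_le_right _ _)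
  have hr : (1 / 2 : ℝ) ≤ ‖ι (orthResidual ι w (e k))‖ := by linarith
  have hr0 : ι (orthResidual ι w (e k)) ≠ 0 := norm_pos_iff.1 (by linarith)
  refine ⟨_, norm_normalize hr0, fun i => ?_, ?_⟩
  · rw [map_smul, inner_smul_right, inner_orthResidual ι hw, mul_zero]
  · rw [map_smul_eq_mul, Complex.norm_real, norm_inv, norm_norm,
      inv_mul_le_iff₀ (by linarith)]
    nlinarith

/-- This is the forced choice: adjoining v puts d in the span. If d is already there, any orthogonal
unit vector serves, with c = 0. -/
theorem exists_orthogonal_residual (ι : V →ₗ[ℂ] E) {e : ℕ → V} (he : ∀ k, ‖ι (e k)‖ = 1)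
    (hweak : ∀ w, Tendsto (fun k => inner ℂ (ι w) (ι (e k))) atTop (𝓝 0))
    {n : ℕ} {w : Fin n → V} (hw : Orthonormal ℂ (fun i => ι (w i))) (d : V) :
    ∃ v, ‖ι v‖ = 1 ∧ (∀ i, inner ℂ (ι (w i)) (ι v) = 0) ∧
      ∃ c : ℂ, ι (orthResidual ι w d) = c • ι v := by
  by_cases hr : ι (orthResidual ι w d) = 0
  · obtain ⟨v, h1, h0, -⟩ := exists_small_orthogonal ι he hweak (p := 0) (by simp) hw one_pos
    exact ⟨v, h1, h0, 0, by rw [hr, zero_smul]⟩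
  · refine ⟨_, norm_normalize hr, fun i => ?_, (‖ι (orthResidual ι w d)‖ : ℂ), ?_⟩
    · rw [map_smul, inner_smul_right, inner_orthResidual ι hw, mul_zero]
    · rw [map_smul, smul_smul, ← Complex.ofReal_mul, mul_inv_cancel₀ (norm_ne_zero_iff.2 hr),
        Complex.ofReal_one, one_smul]

theorem mem_span_of_residual (ι : V →ₗ[ℂ] E) {n : ℕ} {g : ℕ → V} {d : V} {c : ℂ}
    (h : ι (orthResidual ι (fun i : Fin n => g i) d) = c • ι (g n)) :
    ι d ∈ Submodule.span ℂ (Set.range fun k => ι (g k)) := by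
  have hd : ι d = c • ι (g n) +
      ∑ i : Fin n, inner ℂ (ι (g i)) (ι d) • ι (g i) := by
    rw [← h]
    simp [orthResidual, map_sub, map_sum, map_smul]
  rw [hd]
  exact Submodule.add_mem _ (Submodule.smul_mem _ _ (Submodule.subset_span ⟨n, rfl⟩))
    (Submodule.sum_mem _ fun i _ => Submodule.smul_mem _ _ (Submodule.subset_span ⟨i, rfl⟩))

/-! ### Simultaneous choice of the two orthonormal sequences -/

variable {W F : Type*} [AddCommGroup W] [Module ℂ W] [NormedAddCommGroup F]
  [InnerProductSpace ℂ F]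

/-- The requirements on the next pair of vectors in the recursion. -/
structure IsNextPair (ι : V →ₗ[ℂ] E) (κ : W →ₗ[ℂ] F) (A : V →ₗ[ℂ] E) (q : Seminorm ℂ W) (ε : ℝ)
    (d : V) (d' : W) (n : ℕ) (f : Fin n → V) (u : Fin n → W) (a : V) (b : W) : Prop where
  norm_left : ‖ι a‖ = 1
  inner_left : ∀ i, inner ℂ (ι (f i)) (ι a) = 0
  norm_right : ‖κ b‖ = 1
  inner_right : ∀ i, inner ℂ (κ (u i)) (κ b) = 0
  even : Even n → ∃ c : ℂ, κ (orthResidual κ u d') = c • κ b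
  odd : ¬ Even n → ∃ c : ℂ, ι (orthResidual ι f d) = c • ι a
  bound : ‖A a‖ * q b * (1 + q b + ∑ i, q (u i)) ≤ ε
  bound_inner : ∀ i, ‖inner ℂ (A (f i)) (ι a)‖ * (q b * q (u i)) ≤ ε

/-- The forced vector is fixed first, b for even n and a for odd n, and the other is then made small
enough to compensate for its size. -/
theorem exists_isNextPair (ι : V →ₗ[ℂ] E) (κ : W →ₗ[ℂ] F) (A : V →ₗ[ℂ] E)
    {e : ℕ → V} (he : ∀ k, ‖ι (e k)‖ = 1)
    (hweak : ∀ w, Tendsto (fun k => inner ℂ w (ι (e k))) atTop (𝓝 0))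
    (hA : Tendsto (fun k => A (e k)) atTop (𝓝 0))
    {e' : ℕ → W} (he' : ∀ k, ‖κ (e' k)‖ = 1)
    (hweak' : ∀ w, Tendsto (fun k => inner ℂ (κ w) (κ (e' k))) atTop (𝓝 0))
    (q : Seminorm ℂ W) (hq : Tendsto (fun k => q (e' k)) atTop (𝓝 0)) {ε : ℝ} (hε : 0 < ε)
    (d : V) (d' : W) {n : ℕ} {f : Fin n → V} {u : Fin n → W}
    (hf : Orthonormal ℂ (fun i => ι (f i))) (hu : Orthonormal ℂ (fun i => κ (u i))) :
    ∃ x : V × W, IsNextPair ι κ A q ε d d' n f u x.1 x.2 := by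
  have hS : 0 ≤ ∑ i, q (u i) := Finset.sum_nonneg fun i _ => apply_nonneg q _
  have hSi : ∀ i, q (u i) ≤ ∑ i, q (u i) := fun i =>
    Finset.single_le_sum (f := fun i => q (u i)) (fun i _ => apply_nonneg q _) (Finset.mem_univ i)
  set Q := ∑ i, q (u i)
  by_cases hn : Even n
  · obtain ⟨b, hb1, hb0, hbc⟩ := exists_orthogonal_residual κ he' hweak' hu d'
    have hqb : 0 ≤ q b := apply_nonneg q b
    -- L records A together with the functionals ⟪A (f i), ι ·⟫, so that one seminorm controls the
    -- new vector both as a row and as a column of the matrix.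
    let L : V →ₗ[ℂ] (Fin n → ℂ) × E :=
      (LinearMap.pi fun i => (innerₛₗ ℂ (A (f i))).comp ι).prod A
    have hL : Tendsto (fun k => (normSeminorm ℂ ((Fin n → ℂ) × E)).comp L (e k)) atTop (𝓝 0) := by
      have h : Tendsto (fun k => L (e k)) atTop (𝓝 0) :=
        (tendsto_pi_nhds.2 fun i => hweak (A (f i))).prodMk_nhds hA
      simpa using h.norm
    obtain ⟨a, ha1, ha0, hap⟩ := exists_small_orthogonal ι he (fun w => hweak (ι w)) hL hf
      (ε := ε / (1 + q b + Q) ^ 2) (by positivity)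
    have hLa : ‖L a‖ * (1 + q b + Q) ^ 2 ≤ ε := by
      rwa [← le_div_iff₀ (by positivity)]
    have h1 : ‖A a‖ ≤ ‖L a‖ := norm_snd_le (L a)
    have h2 : ∀ i, ‖inner ℂ (A (f i)) (ι a)‖ ≤ ‖L a‖ := fun i =>
      (norm_le_pi_norm (L a).1 i).trans (norm_fst_le (L a))
    refine ⟨(a, b), ha1, ha0, hb1, hb0, fun _ => hbc, fun h => absurd hn h, ?_, fun i => ?_⟩
    · refine le_trans ?_ hLa
      rw [mul_assoc, sq]
      gcongr
      linarith
    · refine le_trans ?_ hLa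
      rw [sq]
      have := hSi i
      have := h2 i
      gcongr <;> linarith
  · obtain ⟨a, ha1, ha0, hac⟩ := exists_orthogonal_residual ι he (fun w => hweak (ι w)) hf d
    have hT : 0 ≤ ∑ i, ‖A (f i)‖ := Finset.sum_nonneg fun i _ => norm_nonneg _
    have hTi : ∀ i, ‖A (f i)‖ ≤ ∑ i, ‖A (f i)‖ := fun i =>
      Finset.single_le_sum (f := fun i => ‖A (f i)‖) (fun i _ => norm_nonneg _) (Finset.mem_univ i)
    set T := ∑ i, ‖A (f i)‖
    -- The cap 1 turns the factor 1 + q b + Q into at most 2 + Q, and 1 + ‖A a‖ + T dominates both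
    -- ‖A a‖ and every ‖A (f i)‖.
    obtain ⟨b, hb1, hb0, hbp⟩ := exists_small_orthogonal κ he' hweak' hq hu
      (ε := min 1 (ε / ((1 + ‖A a‖ + T) * (2 + Q)))) (by positivity)
    have hqb : 0 ≤ q b := apply_nonneg q b
    have hb2 : q b ≤ 1 := hbp.trans (min_le_left _ _)
    have hb3 : (1 + ‖A a‖ + T) * q b * (2 + Q) ≤ ε := by
      have := hbp.trans (min_le_right _ _)
      rw [le_div_iff₀ (by positivity)] at this
      linarith
    refine ⟨(a, b), ha1, ha0, hb1, hb0, fun h => absurd h hn, fun _ => hac, ?_, fun i => ?_⟩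
    · refine le_trans ?_ hb3
      gcongr <;> linarith
    · refine le_trans ?_ hb3
      rw [← mul_assoc]
      have h1 : ‖inner ℂ (A (f i)) (ι a)‖ ≤ 1 + ‖A a‖ + T := by
        have h := norm_inner_le_norm (𝕜 := ℂ) (A (f i)) (ι a)
        rw [ha1, mul_one] at h
        linarith [hTi i, norm_nonneg (A a)]
      have := hSi i
      gcongr
      linarith

/-- Orthonormal sequences `f` and `u` whose spans contain prescribed vectors, such that the matrix
of `A` with respect to `f` is small compared with the seminorms of the `u n`. -/
theorem exists_orthonormal_pair (ι : V →ₗ[ℂ] E) (κ : W →ₗ[ℂ] F) (A : V →ₗ[ℂ] E)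
    {e : ℕ → V} (he : ∀ k, ‖ι (e k)‖ = 1)
    (hweak : ∀ w, Tendsto (fun k => inner ℂ w (ι (e k))) atTop (𝓝 0))
    (hA : Tendsto (fun k => A (e k)) atTop (𝓝 0))
    {e' : ℕ → W} (he' : ∀ k, ‖κ (e' k)‖ = 1)
    (hweak' : ∀ w, Tendsto (fun k => inner ℂ (κ w) (κ (e' k))) atTop (𝓝 0))
    (q : ℕ → Seminorm ℂ W) (hq : ∀ n, Tendsto (fun k => q n (e' k)) atTop (𝓝 0))
    {ε : ℕ → ℝ} (hε : ∀ n, 0 < ε n) (d : ℕ → V) (d' : ℕ → W) :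
    ∃ (f : ℕ → V) (u : ℕ → W), Orthonormal ℂ (fun n => ι (f n)) ∧
      Orthonormal ℂ (fun n => κ (u n)) ∧
      (∀ k, ι (d k) ∈ Submodule.span ℂ (Set.range fun n => ι (f n))) ∧
      (∀ k, κ (d' k) ∈ Submodule.span ℂ (Set.range fun n => κ (u n))) ∧
      (∀ n, ‖A (f n)‖ * q n (u n) ≤ ε n) ∧
      (∀ n m, m ≤ n → ‖inner ℂ (A (f n)) (ι (f m))‖ * (q n (u n) * q n (u m)) ≤ ε n) ∧
      (∀ n m, m < n → ‖inner ℂ (A (f m)) (ι (f n))‖ * (q n (u n) * q n (u m)) ≤ ε n) := by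
  -- Orthonormality is a premise inside the existential, so the choice is defined on all tuples and
  -- the recursion can run before orthonormality is known. The index n / 2 makes step 2k treat `d'
  -- k` and step 2k + 1 treat `d k`.
  have hstep : ∀ (n : ℕ) (g : Fin n → V × W), ∃ x : V × W,
      Orthonormal ℂ (fun i => ι (g i).1) → Orthonormal ℂ (fun i => κ (g i).2) →
      IsNextPair ι κ A (q n) (ε n) (d (n / 2)) (d' (n / 2)) n (fun i => (g i).1)
        (fun i => (g i).2) x.1 x.2 := by
    intro n g
    by_cases h : Orthonormal ℂ (fun i => ι (g i).1) ∧ Orthonormal ℂ (fun i => κ (g i).2)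
    · obtain ⟨x, hx⟩ := exists_isNextPair ι κ A he hweak hA he' hweak' (q n) (hq n) (hε n)
        (d (n / 2)) (d' (n / 2)) h.1 h.2
      exact ⟨x, fun _ _ => hx⟩
    · exact ⟨0, fun h1 h2 => absurd ⟨h1, h2⟩ h⟩
  choose G hG using hstep
  obtain ⟨g, hg⟩ := exists_seq_eq_of_prev G
  have hON : ∀ n, Orthonormal ℂ (fun i : Fin n => ι (g i).1) ∧
      Orthonormal ℂ (fun i : Fin n => κ (g i).2) := by
    intro n
    induction n with
    | zero => exact ⟨⟨fun i => i.elim0, fun i => i.elim0⟩, ⟨fun i => i.elim0, fun i => i.elim0⟩⟩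
    | succ n ih =>
      have h := hG n (fun i => g i) ih.1 ih.2
      rw [← hg n] at h
      exact ⟨orthonormal_fin_succ (x := fun i => ι (g i).1) ih.1 h.norm_left h.inner_left,
        orthonormal_fin_succ (x := fun i => κ (g i).2) ih.2 h.norm_right h.inner_right⟩
  have hN : ∀ n, IsNextPair ι κ A (q n) (ε n) (d (n / 2)) (d' (n / 2)) n (fun i => (g i).1)
      (fun i => (g i).2) (g n).1 (g n).2 := by
    intro n
    have h := hG n (fun i => g i) (hON n).1 (hON n).2
    rwa [← hg n] at h
  have hq0 : ∀ n w, 0 ≤ q n w := fun n w => apply_nonneg (q n) w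
  refine ⟨fun n => (g n).1, fun n => (g n).2, orthonormal_of_fin fun n => (hON n).1,
    orthonormal_of_fin fun n => (hON n).2, fun k => ?_, fun k => ?_, fun n => ?_,
    fun n m hm => ?_, fun n m hm => (hN n).bound_inner ⟨m, hm⟩⟩
  · obtain ⟨c, hc⟩ := (hN (2 * k + 1)).odd (by simp)
    rw [show (2 * k + 1) / 2 = k by omega] at hc
    exact mem_span_of_residual ι (g := fun n => (g n).1) hc
  · obtain ⟨c, hc⟩ := (hN (2 * k)).even (by simp)
    rw [show (2 * k) / 2 = k by omega] at hc
    exact mem_span_of_residual κ (g := fun n => (g n).2) hc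
  · refine le_trans (le_mul_of_one_le_right (mul_nonneg (norm_nonneg _) (hq0 _ _)) ?_) (hN n).bound
    have := Finset.sum_nonneg fun (i : Fin n) (_ : i ∈ Finset.univ) => hq0 n (g i).2
    linarith [hq0 n (g n).2, hN n]
  · refine le_trans ?_ (hN n).bound
    have hS := Finset.sum_nonneg fun (i : Fin n) (_ : i ∈ Finset.univ) => hq0 n (g i).2
    have h1 : ‖inner ℂ (A (g n).1) (ι (g m).1)‖ ≤ ‖A (g n).1‖ := by
      have h := norm_inner_le_norm (𝕜 := ℂ) (A (g n).1) (ι (g m).1)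
      rwa [(hN m).norm_left, mul_one] at h
    have h2 : q n (g m).2 ≤ 1 + q n (g n).2 + ∑ i : Fin n, q n (g i).2 := by
      rcases hm.lt_or_eq with hm | rfl
      · have := Finset.single_le_sum (f := fun i : Fin n => q n (g i).2)
          (fun i _ => hq0 n _) (Finset.mem_univ ⟨m, hm⟩)
        linarith [hq0 n (g n).2]
      · linarith
    rw [← mul_assoc]
    have := hq0 n (g n).2
    have := hq0 n (g m).2
    gcongr

end Abstract

/-! Dense domains, dense sequences and weakly null sequences -/

/-- Von Neumann's graph argument in the Hilbert sum H ⊕ H: a pair orthogonal to the graph of S has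
its second entry in the domain of S*. If y is orthogonal to that domain, (0, y) is in the double
orthogonal complement of the graph, hence in the closed graph itself, and y = S 0 = 0. -/
theorem LinearPMap.dense_adjoint_domain {H : Type*} [NormedAddCommGroup H] [InnerProductSpace ℂ H]
    [CompleteSpace H] {S : H →ₗ.[ℂ] H} (hc : S.IsClosed) :
    Dense (S.adjoint.domain : Set H) := by
  rw [Submodule.dense_iff_topologicalClosure_eq_top, Submodule.topologicalClosure_eq_top_iff,
    Submodule.eq_bot_iff]
  intro y hy
  let M : Submodule ℂ (WithLp 2 (H × H)) :=
    S.graph.comap (WithLp.linearEquiv 2 ℂ (H × H) : WithLp 2 (H × H) →ₗ[ℂ] H × H)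
  have hM : _root_.IsClosed (M : Set (WithLp 2 (H × H))) :=
    _root_.IsClosed.preimage (WithLp.prod_continuous_ofLp 2 H H) hc
  have hmem : WithLp.toLp 2 ((0 : H), y) ∈ M := by
    rw [← hM.submodule_topologicalClosure_eq, ← Submodule.orthogonal_orthogonal_eq_closure,
      Submodule.mem_orthogonal]
    intro x hx
    rw [Submodule.mem_orthogonal] at hx
    have hb : x.snd ∈ S.adjoint.domain := by
      refine LinearPMap.mem_adjoint_domain_of_exists _ ⟨-x.fst, fun z => ?_⟩
      have h := hx (WithLp.toLp 2 ((z : H), S z)) (S.mem_graph z)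
      rw [WithLp.prod_inner_apply] at h
      have h3 : -inner ℂ (z : H) x.fst = inner ℂ (S z) x.snd := neg_eq_of_add_eq_zero_right h
      rw [inner_neg_left, ← inner_conj_symm x.fst, ← inner_conj_symm x.snd, ← h3, _root_.map_neg]
    rw [WithLp.prod_inner_apply]
    simpa using hy _ hb
  obtain ⟨z, hz1, hz2⟩ := (LinearPMap.mem_graph_iff S).1 hmem
  have hz : z = 0 := Subtype.ext hz1
  rw [hz, map_zero] at hz2
  exact hz2.symm

theorem DenseRange.exists_seq_denseRange_comp {V E : Type*} [TopologicalSpace E]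
    [SecondCountableTopology E] {ι : V → E} [Nonempty V] (h : DenseRange ι) :
    ∃ d : ℕ → V, DenseRange (fun n => ι (d n)) := by
  have : Nonempty (Set.range ι) := (Set.range_nonempty ι).to_subtype
  choose d hd using fun n => (TopologicalSpace.denseSeq (Set.range ι) n).2
  refine ⟨d, ?_⟩
  simp only [hd]
  exact (Dense.denseRange_val h).comp (TopologicalSpace.denseRange_denseSeq _)
    continuous_subtype_val

theorem top_le_closure_span {E : Type*} [NormedAddCommGroup E] [InnerProductSpace ℂ E]
    {d g : ℕ → E} (hd : DenseRange d) (h : ∀ k, d k ∈ Submodule.span ℂ (Set.range g)) :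
    ⊤ ≤ (Submodule.span ℂ (Set.range g)).topologicalClosure := by
  rw [top_le_iff, ← Submodule.dense_iff_topologicalClosure_eq_top]
  exact hd.mono (Set.range_subset_iff.2 h)

theorem Orthonormal.tendsto_inner_zero {E : Type*} [NormedAddCommGroup E] [InnerProductSpace ℂ E]
    {e : ℕ → E} (he : Orthonormal ℂ e) (x : E) :
    Tendsto (fun k => inner ℂ x (e k)) atTop (𝓝 0) := by
  have h := (he.inner_products_summable x).tendsto_atTop_zero
  rw [tendsto_zero_iff_norm_tendsto_zero]
  have h2 := h.sqrt
  simpa [norm_inner_symm x] using h2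

/-! ### Schwartz unit vectors that spread out -/

theorem exists_schwartz_norm_toLp_eq_one :
    ∃ φ : SchwartzMap ℝ ℂ, ‖φ.toLp 2 (volume : Measure ℝ)‖ = 1 := by
  let b : ContDiffBump (0 : ℝ) := default
  have hc : HasCompactSupport (fun x => (b x : ℂ)) :=
    b.hasCompactSupport.comp_left (g := fun y : ℝ => (y : ℂ)) Complex.ofReal_zero
  let φ : SchwartzMap ℝ ℂ := hc.toSchwartzMap (Complex.ofRealCLM.contDiff.comp b.contDiff)
  have hφ : SchwartzMap.toLpCLM ℂ ℂ 2 (volume : Measure ℝ) φ ≠ 0 := by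
    intro h
    have h0 : φ = 0 := SchwartzMap.injective_toLp (F := ℂ) 2 (volume : Measure ℝ)
      (h.trans (map_zero (SchwartzMap.toLpCLM ℂ ℂ 2 (volume : Measure ℝ))).symm)
    have h1 : (b 0 : ℂ) = 0 := DFunLike.congr_fun h0 0
    rw [b.one_of_mem_closedBall (Metric.mem_closedBall_self b.rIn_pos.le)] at h1
    simp at h1
  exact ⟨_, norm_normalize (ι := (SchwartzMap.toLpCLM ℂ ℂ 2 (volume : Measure ℝ)).toLinearMap) hφ⟩

/-- The `L²`-normalised dilation `x ↦ √c φ(c x)`. -/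
noncomputable def SchwartzMap.dilate (φ : SchwartzMap ℝ ℂ) (c : ℝˣ) : SchwartzMap ℝ ℂ :=
  (√(c : ℝ) : ℂ) • SchwartzMap.compCLMOfContinuousLinearEquiv ℂ
    (ContinuousLinearEquiv.unitsEquivAut ℝ c) φ

theorem SchwartzMap.dilate_apply (φ : SchwartzMap ℝ ℂ) (c : ℝˣ) (x : ℝ) :
    φ.dilate c x = (√(c : ℝ) : ℂ) * φ (c * x) := by
  simp [SchwartzMap.dilate, mul_comm]

theorem SchwartzMap.norm_toLp_dilate (φ : SchwartzMap ℝ ℂ) (c : ℝˣ) (hc : 0 < (c : ℝ)) :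
    ‖(φ.dilate c).toLp 2 (volume : Measure ℝ)‖ = ‖φ.toLp 2 (volume : Measure ℝ)‖ := by
  have h : ∀ ψ : SchwartzMap ℝ ℂ, ‖ψ.toLp 2 (volume : Measure ℝ)‖ =
      (∫ x, ‖ψ x‖ ^ 2) ^ (2⁻¹ : ℝ) := fun ψ => by
    have := SchwartzMap.norm_toLp' (f := ψ) (p := 2) (μ := (volume : Measure ℝ)) (by simp) (by simp)
    simpa using this
  rw [h, h]
  congr 1
  have h2 : ∀ x, ‖φ.dilate c x‖ ^ 2 = c * ‖φ (c * x)‖ ^ 2 := fun x => by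
    rw [SchwartzMap.dilate_apply, norm_mul, mul_pow, Complex.norm_real, Real.norm_eq_abs, sq_abs,
      Real.sq_sqrt hc.le]
  simp only [h2]
  rw [integral_const_mul, Measure.integral_comp_mul_left (fun x => ‖φ x‖ ^ 2), abs_inv,
    abs_of_pos hc, smul_eq_mul, mul_inv_cancel_left₀ hc.ne']

/-- Each derivative contributes a factor c ≤ 1; the factor √c of the normalisation survives even for
i = 0. -/
theorem SchwartzMap.seminorm_dilate_le (φ : SchwartzMap ℝ ℂ) (c : ℝˣ) (hc : 0 < (c : ℝ))
    (hc1 : (c : ℝ) ≤ 1) (i : ℕ) :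
    SchwartzMap.seminorm ℂ 0 i (φ.dilate c) ≤ √(c : ℝ) * SchwartzMap.seminorm ℂ 0 i φ := by
  refine SchwartzMap.seminorm_le_bound' ℂ 0 i _ (by positivity) fun x => ?_
  have h : ⇑(φ.dilate c) = fun x => (√(c : ℝ) : ℂ) * φ (c * x) := funext (φ.dilate_apply c)
  have h2 := φ.le_seminorm' ℂ 0 i (c * x)
  rw [pow_zero, one_mul] at h2 ⊢
  rw [h, iteratedDeriv_const_mul_field, iteratedDeriv_comp_const_smul (φ.smooth i), norm_mul,
    Complex.norm_real, Real.norm_eq_abs, abs_of_nonneg (Real.sqrt_nonneg _), norm_smul, norm_pow,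
    Real.norm_eq_abs, abs_of_pos hc]
  gcongr
  exact (mul_le_of_le_one_left (norm_nonneg _) (pow_le_one₀ hc.le hc1)).trans h2

/-- Wide dilates: unit vectors of `L²` that tend weakly to zero, with all derivatives tending
uniformly to zero. -/
theorem exists_schwartz_spreading : ∃ e : ℕ → SchwartzMap ℝ ℂ,
    (∀ k, ‖(e k).toLp 2 (volume : Measure ℝ)‖ = 1) ∧
    (∀ w : SchwartzMap ℝ ℂ, Tendsto (fun k => inner ℂ (w.toLp 2 (volume : Measure ℝ))
      ((e k).toLp 2 (volume : Measure ℝ))) atTop (𝓝 0)) ∧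
    ∀ i, Tendsto (fun k => SchwartzMap.seminorm ℂ 0 i (e k)) atTop (𝓝 0) := by
  obtain ⟨φ, hφ⟩ := exists_schwartz_norm_toLp_eq_one
  let c : ℕ → ℝˣ := fun k => Units.mk0 (1 / ((k : ℝ) + 1)) (by positivity)
  have hc : ∀ k, (c k : ℝ) = 1 / ((k : ℝ) + 1) := fun k => rfl
  have hc0 : ∀ k, 0 < (c k : ℝ) := fun k => by rw [hc]; positivity
  have hc1 : ∀ k, (c k : ℝ) ≤ 1 := fun k => by
    rw [hc, div_le_one (by positivity)]; simp
  have hs : Tendsto (fun k => √(c k : ℝ)) atTop (𝓝 0) := by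
    simpa [hc] using (tendsto_one_div_add_atTop_nhds_zero_nat (𝕜 := ℝ)).sqrt
  have hsem : ∀ i, Tendsto (fun k => SchwartzMap.seminorm ℂ 0 i (φ.dilate (c k))) atTop (𝓝 0) :=
    fun i => squeeze_zero (fun k => apply_nonneg _ _)
      (fun k => φ.seminorm_dilate_le (c k) (hc0 k) (hc1 k) i)
      (by simpa using hs.mul_const (SchwartzMap.seminorm ℂ 0 i φ))
  refine ⟨fun k => φ.dilate (c k), fun k => (φ.norm_toLp_dilate _ (hc0 k)).trans hφ,
    fun w => ?_, hsem⟩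
  -- An inner product with an integrable w is at most the L¹ norm of w times the sup norm of the
  -- dilate.
  refine squeeze_zero_norm (a := fun k =>
    (∫ x, ‖w x‖) * SchwartzMap.seminorm ℂ 0 0 (φ.dilate (c k))) (fun k => ?_)
    (by simpa using (hsem 0).const_mul (∫ x, ‖w x‖))
  beta_reduce
  rw [SchwartzMap.inner_toL2_toL2_eq w (φ.dilate (c k)) volume, ← integral_mul_const]
  refine norm_integral_le_of_norm_le (w.integrable.norm.mul_const _) (Eventually.of_forall fun x => ?_)
  refine (norm_inner_le_norm _ _).trans ?_
  gcongr
  exact (φ.dilate (c k)).norm_le_seminorm ℂ x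

/-! The kernel -/

/-- Twice the maximum is at least the sum of the indices, so (1/4)^max is bounded by a product of
two geometric terms; only finitely many pairs escape the bound. -/
theorem summable_prod_of_max_bound {b : ℕ × ℕ → ℝ} (hb : ∀ p, 0 ≤ b p) (M : ℕ)
    (h : ∀ p : ℕ × ℕ, M ≤ max p.1 p.2 → b p ≤ (1 / 4) ^ max p.1 p.2) : Summable b := by
  have hg : Summable fun p : ℕ × ℕ => (1 / 2 : ℝ) ^ p.1 * (1 / 2) ^ p.2 :=
    summable_geometric_two.mul_of_nonneg summable_geometric_two (fun _ => by positivity)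
      (fun _ => by positivity)
  refine hg.of_norm_bounded_eventually ?_
  have hfin : {p : ℕ × ℕ | ¬ M ≤ max p.1 p.2}.Finite :=
    ((Set.finite_Iio M).prod (Set.finite_Iio M)).subset fun p hp => by
      exact max_lt_iff.1 (not_le.1 hp)
  filter_upwards [hfin.compl_mem_cofinite] with p hp
  have hp' : M ≤ max p.1 p.2 := not_not.1 hp
  rw [Real.norm_of_nonneg (hb p)]
  refine (h p hp').trans ?_
  rw [← pow_add, show (1 / 4 : ℝ) = (1 / 2) ^ 2 by norm_num, ← pow_mul]
  exact pow_le_pow_of_le_one (by norm_num) (by norm_num) (by omega)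

section Kernel

variable {H : Type*} [NormedAddCommGroup H] [InnerProductSpace ℂ H]
  (f : HilbertBasis ℕ ℂ H) (w : ℕ → SchwartzMap ℝ ℂ) (y : ℕ → H)

/-- The kernel with the expansion `∑ ⟪y n, f m⟫ w n (s) conj (w m (t))`. -/
noncomputable def seriesKernel (s t : ℝ) : ℂ :=
  ∑' p : ℕ × ℕ, inner ℂ (y p.1) (f p.2) * (w p.1 s * conj (w p.2 t))

variable {f w y} {u : HilbertBasis ℕ ℂ L2R} {U : H ≃ₗᵢ[ℂ] L2R}

/-- The double series converges absolutely at every point, whereas k(s) is a limit in L². The two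
are matched almost everywhere twice: over m, to identify each U (y n), and then over n. -/
theorem isCarlemanFunction_seriesKernel
    (hu : ∀ n, u n = (w n).toLp 2 (volume : Measure ℝ)) (hU : ∀ n, U (f n) = u n)
    (h1 : ∀ i, Summable fun n => SchwartzMap.seminorm ℂ 0 i (w n) * ‖y n‖)
    (h2 : ∀ i j, Summable fun p : ℕ × ℕ => ‖inner ℂ (y p.1) (f p.2)‖ *
      (SchwartzMap.seminorm ℂ 0 i (w p.1) * SchwartzMap.seminorm ℂ 0 j (w p.2))) :
    IsCarlemanFunction (seriesKernel f w y) (fun s => ∑' n, conj (w n s) • U (y n)) := by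
  intro s
  have hs : ∀ t, Summable fun p : ℕ × ℕ => inner ℂ (f p.2) (y p.1) * (conj (w p.1 s) * w p.2 t) :=
    fun t => Summable.of_norm_bounded (h2 0 0) fun p => by
      rw [norm_mul, norm_inner_symm, norm_mul, RCLike.norm_conj]
      gcongr
      · exact (w p.1).norm_le_seminorm ℂ s
      · exact (w p.2).norm_le_seminorm ℂ t
  have hK : ∀ t, conj (seriesKernel f w y s t) =
      ∑' n, ∑' m, inner ℂ (f m) (y n) * (conj (w n s) * w m t) := fun t => by
    rw [seriesKernel, Complex.conj_tsum, ← (hs t).tsum_prod]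
    refine tsum_congr fun p => ?_
    simp [map_mul, inner_conj_symm]
  have hw : ∀ᵐ t : ℝ, ∀ m, (u m) t = w m t := ae_all_iff.2 fun m => by
    rw [hu]; exact (w m).coeFn_toLp 2 volume
  have hpart : ∀ (c : ℕ → ℂ) (N : ℕ), ∀ᵐ t : ℝ,
      (∑ m ∈ Finset.range N, c m • u m : L2R) t = ∑ m ∈ Finset.range N, c m * w m t := by
    intro c N
    have hc : ∀ᵐ t : ℝ, ∀ m, (c m • u m : L2R) t = c m * (u m) t :=
      ae_all_iff.2 fun m => Lp.coeFn_smul _ _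
    filter_upwards [Lp_coeFn_sum (Finset.range N) (fun m => c m • u m), hw, hc] with t ht hwt hct
    rw [ht]
    exact Finset.sum_congr rfl fun m _ => by rw [hct, hwt]
  have hz : ∀ n, (conj (w n s) • U (y n) : L2R) =ᵐ[volume]
      fun t => ∑' m, inner ℂ (f m) (y n) * (conj (w n s) * w m t) := by
    intro n
    have hsum : HasSum (fun m => (conj (w n s) * inner ℂ (f m) (y n)) • u m)
        (conj (w n s) • U (y n)) := by
      have h := ((u.hasSum_repr (U (y n))).const_smul (conj (w n s)))
      simpa only [HilbertBasis.repr_apply_apply, ← hU, LinearIsometryEquiv.inner_map_map,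
        smul_smul] using h
    refine Lp_ae_eq_of_tendsto hsum.tendsto_sum_nat ?_
    filter_upwards [ae_all_iff.2 (hpart fun m => conj (w n s) * inner ℂ (f m) (y n))] with t ht
    simp only [ht]
    have h := ((hs t).prod_factor n).hasSum.tendsto_sum_nat
    refine h.congr fun N => Finset.sum_congr rfl fun m _ => by ring
  have hsum : HasSum (fun n => conj (w n s) • U (y n)) (∑' n, conj (w n s) • U (y n)) :=
    (Summable.of_norm_bounded (h1 0) fun n => by
      simpa using norm_conj_smul_le (w n) (U (y n)) s).hasSum
  refine Lp_ae_eq_of_tendsto hsum.tendsto_sum_nat ?_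
  filter_upwards [ae_all_iff.2 hz, ae_all_iff.2 fun N =>
    Lp_coeFn_sum (Finset.range N) (fun n => conj (w n s) • U (y n))] with t ht hN
  rw [hK]
  refine (hs t).prod.hasSum.tendsto_sum_nat.congr fun N => ?_
  rw [hN]
  exact Finset.sum_congr rfl fun n _ => (ht n).symm

theorem isCarlemanOperator_seriesKernel {S : H →ₗ.[ℂ] H} (hS : Dense (S.domain : Set H))
    (hu : ∀ n, u n = (w n).toLp 2 (volume : Measure ℝ)) (hU : ∀ n, U (f n) = u n)
    (hy : ∀ n (x : S.domain), inner ℂ (y n) (x : H) = inner ℂ (f n) (S x))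
    (h1 : ∀ i, Summable fun n => SchwartzMap.seminorm ℂ 0 i (w n) * ‖y n‖)
    (h2 : ∀ i j, Summable fun p : ℕ × ℕ => ‖inner ℂ (y p.1) (f p.2)‖ *
      (SchwartzMap.seminorm ℂ 0 i (w p.1) * SchwartzMap.seminorm ℂ 0 j (w p.2))) :
    IsCarlemanOperator (unitaryConj U S) (seriesKernel f w y) := by
  set k : ℝ → L2R := fun s => ∑' n, conj (w n s) • U (y n)
  have hkK : IsCarlemanFunction (seriesKernel f w y) k :=
    isCarlemanFunction_seriesKernel hu hU h1 h2
  have hKk : ∀ s, (fun t => conj (k s t)) =ᵐ[volume] seriesKernel f w y s := fun s => by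
    filter_upwards [hkK s] with t ht
    rw [ht, Complex.conj_conj]
  have hcont : Continuous fun p : ℝ × ℝ => seriesKernel f w y p.1 p.2 :=
    (hasC0Partials_tsum 0 (fun p : ℕ × ℕ => inner ℂ (y p.1) (f p.2)) (fun p => w p.1)
      (fun p => w p.2) h2).1
  refine ⟨⟨?_, hcont.aestronglyMeasurable, fun g => ?_⟩, Eventually.of_forall fun s => ?_⟩
  · exact hS.preimage U.symm.toHomeomorph.isOpenMap
  · have hint : ∀ s, Integrable (fun t => seriesKernel f w y s t * (g : L2R) t) ∧
        ∫ t, seriesKernel f w y s t * (g : L2R) t = inner ℂ (k s) (g : L2R) := fun s => by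
      have hae : (fun t => inner ℂ (k s t) ((g : L2R) t)) =ᵐ[volume]
          fun t => seriesKernel f w y s t * (g : L2R) t := by
        filter_upwards [hKk s] with t ht
        rw [← ht, RCLike.inner_apply, mul_comm]
      exact ⟨(L2.integrable_inner (𝕜 := ℂ) (k s) (g : L2R)).congr hae,
        (integral_congr_ae hae).symm⟩
    obtain ⟨T, hT⟩ : ∃ T, T = unitaryConj U S g := ⟨_, rfl⟩
    -- The adjoint relation turns the Fourier coefficients of Tg into inner products with g itself,
    -- so the expansion of Tg at s is termwise that of ⟪k s, g⟫.
    have hcoef : ∀ n, inner ℂ (U (y n)) (g : L2R) = inner ℂ (u n) T := fun n => by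
      have h := hy n ⟨U.symm (g : L2R), g.2⟩
      rw [← hU, show T = U (S ⟨U.symm (g : L2R), g.2⟩) from hT,
        LinearIsometryEquiv.inner_map_map, ← h]
      rw [← U.inner_map_map, LinearIsometryEquiv.apply_symm_apply]
    have hTk : (T : ℝ → ℂ) =ᵐ[volume] fun s => inner ℂ (k s) (g : L2R) := by
      have hsumT : HasSum (fun n => inner ℂ (u n) T • u n) T := by
        simpa only [HilbertBasis.repr_apply_apply] using u.hasSum_repr T
      refine Lp_ae_eq_of_tendsto hsumT.tendsto_sum_nat ?_
      have hw : ∀ᵐ s : ℝ, ∀ n, (inner ℂ (u n) T • u n : L2R) s = inner ℂ (u n) T * w n s :=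
        ae_all_iff.2 fun n => by
          filter_upwards [Lp.coeFn_smul (inner ℂ (u n) T) (u n), (w n).coeFn_toLp 2 volume]
            with s hs hws
          rw [hs, Pi.smul_apply, smul_eq_mul, ← hws, ← hu]
      filter_upwards [hw, ae_all_iff.2 fun N =>
        Lp_coeFn_sum (Finset.range N) (fun n => inner ℂ (u n) T • u n)] with s hs hN
      have hsum : HasSum (fun n => conj (w n s) • U (y n)) (k s) :=
        (Summable.of_norm_bounded (h1 0) fun n => by
          simpa using norm_conj_smul_le (w n) (U (y n)) s).hasSum
      have h := (hsum.map (innerSLFlip ℂ (g : L2R)) (innerSLFlip ℂ (g : L2R)).continuous)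
      refine h.tendsto_sum_nat.congr fun N => ?_
      rw [hN]
      refine Finset.sum_congr rfl fun n _ => ?_
      rw [hs, ← hcoef, Function.comp_apply, innerSLFlip_apply_apply, inner_smul_left,
        Complex.conj_conj, mul_comm]
    filter_upwards [hTk] with s hs
    exact ⟨(hint s).1, by rw [(hint s).2, ← hT, hs]⟩
  · have h := (Lp.memLp (k s)).star
    exact h.ae_eq (hKk s)

theorem isSKInftyKernel_seriesKernel
    (hu : ∀ n, u n = (w n).toLp 2 (volume : Measure ℝ)) (hU : ∀ n, U (f n) = u n)
    (h1 : ∀ i, Summable fun n => SchwartzMap.seminorm ℂ 0 i (w n) * ‖y n‖)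
    (h2 : ∀ i j, Summable fun p : ℕ × ℕ => ‖inner ℂ (y p.1) (f p.2)‖ *
      (SchwartzMap.seminorm ℂ 0 i (w p.1) * SchwartzMap.seminorm ℂ 0 j (w p.2))) :
    IsSKInftyKernel (seriesKernel f w y) := fun m =>
  ⟨hasC0Partials_tsum m (fun p : ℕ × ℕ => inner ℂ (y p.1) (f p.2)) (fun p => w p.1)
      (fun p => w p.2) h2, _, isCarlemanFunction_seriesKernel hu hU h1 h2,
    hasC0Derivs_tsum m w (fun n => U (y n)) (by simpa using h1)⟩

end Kernel

/-! ### Growing seminorms and the theorem -/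

/-- The supremum of the first `n + 1` derivative seminorms. -/
noncomputable def supSeminorm (n : ℕ) : Seminorm ℂ (SchwartzMap ℝ ℂ) :=
  (Finset.range (n + 1)).sup fun i => SchwartzMap.seminorm ℂ 0 i

theorem seminorm_le_supSeminorm {i n : ℕ} (h : i ≤ n) (φ : SchwartzMap ℝ ℂ) :
    SchwartzMap.seminorm ℂ 0 i φ ≤ supSeminorm n φ :=
  (Finset.le_sup (f := fun i => SchwartzMap.seminorm ℂ 0 i)
    (Finset.mem_range.2 (Nat.lt_succ_of_le h)) : _ ≤ supSeminorm n) φ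

theorem tendsto_supSeminorm {e : ℕ → SchwartzMap ℝ ℂ}
    (h : ∀ i, Tendsto (fun k => SchwartzMap.seminorm ℂ 0 i (e k)) atTop (𝓝 0)) (n : ℕ) :
    Tendsto (fun k => supSeminorm n (e k)) atTop (𝓝 0) := by
  refine squeeze_zero (fun k => apply_nonneg _ _) (fun k => ?_)
    (g := fun k => ∑ i ∈ Finset.range (n + 1), SchwartzMap.seminorm ℂ 0 i (e k))
    (by simpa using tendsto_finsetSum (Finset.range (n + 1)) fun i _ => h i)
  refine Seminorm.finset_sup_apply_le (Finset.sum_nonneg fun i _ => apply_nonneg _ _) fun i hi => ?_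
  exact Finset.single_le_sum (f := fun i => SchwartzMap.seminorm ℂ 0 i (e k))
    (fun i _ => apply_nonneg _ _) hi

theorem mainTheorem1 {H : Type*} [NormedAddCommGroup H] [InnerProductSpace ℂ H] [CompleteSpace H]
    [TopologicalSpace.SeparableSpace H] (S : H →ₗ.[ℂ] H)
    (hS : S ∈ closedOpsWithAdjointLimitPoint H 0) :
    ∃ (f : HilbertBasis ℕ ℂ H) (u : HilbertBasis ℕ ℂ L2R) (U : H ≃ₗᵢ[ℂ] L2R),
      (∀ n, IsArbitrarilySmooth (u n)) ∧
      (∀ n, U (f n) = u n) ∧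
      ∃ K : ℝ → ℝ → ℂ, IsCarlemanOperator (unitaryConj U S) K ∧ IsSKInftyKernel K := by
  obtain ⟨hdense, hclosed, e, he, hz⟩ := hS
  have : SecondCountableTopology H := UniformSpace.secondCountable_of_separable H
  have : Fact ((2 : ENNReal) ≠ ⊤) := ⟨by simp⟩
  obtain ⟨d, hd⟩ := DenseRange.exists_seq_denseRange_comp
    (LinearPMap.dense_adjoint_domain hclosed).denseRange_val
  obtain ⟨d', hd'⟩ := DenseRange.exists_seq_denseRange_comp
    (SchwartzMap.denseRange_toLpCLM (F := ℂ) (p := 2) (μ := (volume : Measure ℝ)) (by simp))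
  obtain ⟨e', he', hweak', hq⟩ := exists_schwartz_spreading
  have hA : Tendsto (fun k => S.adjoint.toFun (e k)) atTop (𝓝 0) := by
    rw [tendsto_zero_iff_norm_tendsto_zero]
    simpa using hz
  -- Step n controls derivatives up to order n only. For fixed orders i and j this covers all but
  -- finitely many terms, which is enough for summability.
  obtain ⟨f, w, hf, hw, hdf, hdw, hb1, hb2, hb3⟩ := exists_orthonormal_pair
    S.adjoint.domain.subtype (SchwartzMap.toLpCLM ℂ ℂ 2 (volume : Measure ℝ)).toLinearMap
    S.adjoint.toFun he.1 he.tendsto_inner_zero hA he' hweak' supSeminorm (tendsto_supSeminorm hq)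
    (ε := fun n => (1 / 4) ^ n) (fun n => by positivity) d d'
  let F : HilbertBasis ℕ ℂ H := HilbertBasis.mk hf (top_le_closure_span hd hdf)
  let u : HilbertBasis ℕ ℂ L2R := HilbertBasis.mk hw (top_le_closure_span hd' hdw)
  have hF : ∀ n, F n = f n := fun n => congrFun (HilbertBasis.coe_mk hf _) n
  have hu : ∀ n, u n = (w n).toLp 2 (volume : Measure ℝ) :=
    fun n => congrFun (HilbertBasis.coe_mk hw _) n
  let U : H ≃ₗᵢ[ℂ] L2R := F.repr.trans u.repr.symm
  have hU : ∀ n, U (F n) = u n := fun n => by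
    simp [U, HilbertBasis.repr_self, HilbertBasis.repr_symm_single]
  have hy : ∀ n (x : S.domain), inner ℂ (S.adjoint (f n)) (x : H) = inner ℂ (F n) (S x) :=
    fun n x => by rw [hF]; exact S.adjoint_isFormalAdjoint hdense (f n) x
  have h1 : ∀ i, Summable fun n => SchwartzMap.seminorm ℂ 0 i (w n) * ‖S.adjoint (f n)‖ := by
    intro i
    refine (summable_geometric_of_lt_one (r := (1 / 4 : ℝ)) (by norm_num)
      (by norm_num)).of_norm_bounded_eventually_nat ?_
    filter_upwards [eventually_ge_atTop i] with n hn
    rw [Real.norm_of_nonneg (by positivity), mul_comm]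
    exact (mul_le_mul_of_nonneg_left (seminorm_le_supSeminorm hn _) (norm_nonneg _)).trans (hb1 n)
  have h2 : ∀ i j, Summable fun p : ℕ × ℕ => ‖inner ℂ (S.adjoint (f p.1)) (F p.2)‖ *
      (SchwartzMap.seminorm ℂ 0 i (w p.1) * SchwartzMap.seminorm ℂ 0 j (w p.2)) := by
    intro i j
    refine summable_prod_of_max_bound (fun p => by positivity) (max i j) fun p hp => ?_
    have hi := seminorm_le_supSeminorm ((le_max_left i j).trans hp) (w p.1)
    have hj := seminorm_le_supSeminorm ((le_max_right i j).trans hp) (w p.2)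
    refine (mul_le_mul_of_nonneg_left (mul_le_mul hi hj (apply_nonneg _ _) (apply_nonneg _ _))
      (norm_nonneg _)).trans ?_
    rw [hF]
    rcases le_or_gt p.2 p.1 with h | h
    · rw [max_eq_left h]
      exact hb2 p.1 p.2 h
    · rw [max_eq_right h.le, mul_comm (supSeminorm p.2 (w p.1))]
      exact hb3 p.2 p.1 h
  refine ⟨F, u, U, fun n => ⟨w n, ?_, fun m => (w n).hasC0Derivs m⟩, hU, _,
    isCarlemanOperator_seriesKernel hdense hu hU hy h1 h2,
    isSKInftyKernel_seriesKernel hu hU h1 h2⟩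
  rw [hu]
  exact (w n).coeFn_toLp 2 volume
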